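/- Let $q$ be a prime power and $\mathbb F_q$ the field with $q$ elements. For a nonzero polynomial $P\in\mathbb F_q[X]$ let $\mu(P)=\#(\mathbb F_q[X]/(P))^\star$ be the number of invertible elements of the quotient ring $\mathbb F_q[X]/(P)$. Let $S\subseteq\mathbb F_q$ be a subset with $\#S=n$, and let $h$ be a positive integer with $h<q$; if $n=q$, assume moreover that $h\neq 1$. Then the set of values $\mu(P)$, where $P$ ranges over the polynomials in $\mathbb F_q[X]$ of degree $h$ with $P(x)\neq 0$ for all $x\in S$, is nonempty, and its smallest element $\mu(q,n,h)$ depends only on $q,n,h$ and is given as follows: - if $q\ge n+h$, then $\mu(q,n,h)=(q-1)^h$; - if $n<q<n+h$ and $n+h-q$ is even, then $\mu(q,n,h)=(q-1)^{q-n}(q^2-1)^{(n+h-q)/2}$; - if $n<q<n+h$ and $n+h-q$ is odd, then $\mu(q,n,h)=q(q-1)^{q-n}(q^2-1)^{(n+h-q-1)/2}$; - if $q=n$ and $h$ is even, then $\mu(q,n,h)=(q^2-1)^{h/2}$; - if $q=n$ and $h$ is odd (so $h\ge 3$), then $\mu(q,n,h)=(q^2-1)^{(h-3)/2}(q^3-1)$.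 -/

import Mathlib

open Polynomial

/-- `unitCount P` is the number of invertible elements of the quotient ring `F[X] / (P)`. -/
noncomputable def unitCount {F : Type*} [Field F] (P : F[X]) : ℕ :=
  Nat.card (F[X] ⧸ Ideal.span {P})ˣ

/-- The set of all values `unitCount P`, where `P` runs through the polynomials of degree `h`
that have no zero in `S`. -/
def unitCountValues {F : Type*} [Field F] (S : Finset F) (h : ℕ) : Set ℕ :=
  {m | ∃ P : F[X], P.degree = (h : WithBot ℕ) ∧ (∀ x ∈ S, P.eval x ≠ 0) ∧ unitCount P = m}

open UniqueFactorizationMonoid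

/-! ### Euler product for the proportion of units. -/

section UnitDensity

variable {F : Type*} [Field F]

/-! For fixed degree, minimising `unitCount P` means minimising `unitDensity P`, which is the
product of 1 - q^(-deg p) over the distinct monic prime factors p
(`unitDensity_eq_prod_primeFactors`). Low-degree primes cost most density, and the degrees of the
distinct primes sum to at most h. At most q - n of them are linear, so the optimum takes as many
linear primes as allowed, then quadratic ones. An odd leftover degree is spent on repeating a linear
factor, which multiplies the count by q. If n = q there is no linear factor to repeat; odd degree
then forces a prime of odd degree at least 3, and one cubic is best. Since h < q, there are enough
irreducible quadratics to attain the bounds. -/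

lemma isUnit_quotient_mk_iff_isCoprime {R : Type*} [CommRing R] (a b : R) :
    IsUnit (Ideal.Quotient.mk (Ideal.span {b}) a) ↔ IsCoprime a b := by
  constructor
  · intro hu
    obtain ⟨c, hc⟩ := hu.exists_right_inv
    obtain ⟨c, rfl⟩ := Ideal.Quotient.mk_surjective c
    rw [← map_mul, ← map_one (Ideal.Quotient.mk _), Ideal.Quotient.eq,
      Ideal.mem_span_singleton] at hc
    obtain ⟨d, hd⟩ := hc
    exact ⟨c, -d, by linear_combination hd⟩
  · rintro ⟨c, d, hcd⟩
    refine IsUnit.of_mul_eq_one (Ideal.Quotient.mk _ c) ?_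
    rw [← map_mul, ← map_one (Ideal.Quotient.mk _), Ideal.Quotient.eq, Ideal.mem_span_singleton]
    exact ⟨-d, by linear_combination hcd⟩

/-- The fibres of a surjective homomorphism are cosets of its kernel. -/
lemma natCard_subtype_comp_surjective {G H : Type*} [AddGroup G] [AddGroup H] (φ : G →+ H)
    (hφ : Function.Surjective φ) (p : H → Prop) :
    Nat.card {x // p (φ x)} = Nat.card {y // p y} * Nat.card φ.ker := by
  rw [← Nat.card_prod]
  obtain ⟨s, hs⟩ := hφ.hasRightInverse
  refine Nat.card_congr
    { toFun := fun x => (⟨φ x, x.2⟩, ⟨x - s (φ x), by simp [AddMonoidHom.mem_ker, hs (φ x)]⟩)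
      invFun := fun y => ⟨y.2 + s y.1, by
        have h := AddMonoidHom.mem_ker.1 y.2.2
        simp [h, hs y.1.1, y.1.2]⟩
      left_inv := fun x => by simp
      right_inv := fun y => by
        have h := AddMonoidHom.mem_ker.1 y.2.2
        ext <;> simp [h, hs y.1.1] }

lemma natCard_quotient_span_singleton {P : F[X]} (hP : P ≠ 0) :
    Nat.card (F[X] ⧸ Ideal.span {P}) = Nat.card F ^ P.natDegree := by
  have : Module.Finite F (F[X] ⧸ Ideal.span {P}) := (AdjoinRoot.powerBasis hP).finite
  have h := Module.natCard_eq_pow_finrank (K := F) (V := F[X] ⧸ Ideal.span {P})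
  rwa [finrank_quotient_span_eq_natDegree] at h

lemma unitCount_eq_natCard_isUnit (P : F[X]) :
    unitCount P = Nat.card {x : F[X] ⧸ Ideal.span {P} // IsUnit x} :=
  Nat.card_congr ⟨fun u => ⟨u, u.isUnit⟩, fun x => x.2.unit, fun _ => by ext; rfl, fun _ => rfl⟩

/-- The proportion of units in the quotient ring `F[X] / (P)`. -/
noncomputable def unitDensity (P : F[X]) : ℚ :=
  unitCount P / (Nat.card F : ℚ) ^ P.natDegree

variable [Finite F]

lemma natCard_cast_pos : (0 : ℚ) < Nat.card F := by exact_mod_cast Nat.card_pos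

lemma one_lt_natCard_cast : (1 : ℚ) < Nat.card F := by exact_mod_cast Finite.one_lt_card

/-- Being coprime to P * Q is the same as being coprime to P, so the units upstairs are the full
preimage of the units modulo P. -/
lemma unitDensity_mul_of_dvd {P Q : F[X]} (hP : P ≠ 0) (hQ : Q ≠ 0) (hQP : Q ∣ P) :
    unitDensity (P * Q) = unitDensity P := by
  have hle : Ideal.span {P * Q} ≤ Ideal.span {P} :=
    Ideal.span_singleton_le_span_singleton.2 (dvd_mul_right P Q)
  let φ := Ideal.Quotient.factor hle
  have hφ : Function.Surjective φ := Ideal.Quotient.factor_surjective hle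
  have hu : ∀ x, IsUnit x ↔ IsUnit (φ x) := by
    intro x
    obtain ⟨f, rfl⟩ := Ideal.Quotient.mk_surjective x
    rw [Ideal.Quotient.factor_mk, isUnit_quotient_mk_iff_isCoprime,
      isUnit_quotient_mk_iff_isCoprime]
    exact ⟨fun h => h.of_mul_right_left, fun h => h.mul_right (h.of_isCoprime_of_dvd_right hQP)⟩
  have h1 := natCard_subtype_comp_surjective φ.toAddMonoidHom hφ IsUnit
  -- The trivial predicate counts the whole ring, so the kernel's order cancels in the density.
  have h2 := natCard_subtype_comp_surjective φ.toAddMonoidHom hφ (fun _ => True)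
  have h3 : unitCount (P * Q) = Nat.card {x // IsUnit (φ x)} := by
    rw [unitCount_eq_natCard_isUnit]
    exact Nat.card_congr (Equiv.subtypeEquivRight hu)
  have h4 : unitCount (P * Q) = unitCount P * Nat.card φ.toAddMonoidHom.ker := by
    rw [h3, unitCount_eq_natCard_isUnit P]
    exact h1
  rw [Nat.card_congr (Equiv.subtypeUnivEquiv fun _ => trivial),
    Nat.card_congr (Equiv.subtypeUnivEquiv fun _ => trivial),
    natCard_quotient_span_singleton (mul_ne_zero hP hQ), natCard_quotient_span_singleton hP] at h2
  have hpos := natCard_cast_pos (F := F)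
  rw [unitDensity, unitDensity, div_eq_div_iff (by positivity) (by positivity)]
  norm_cast
  rw [h4, h2]
  ring

omit [Finite F] in
lemma unitCount_mul_of_isCoprime {P Q : F[X]} (h : IsCoprime P Q) :
    unitCount (P * Q) = unitCount P * unitCount Q := by
  have hI : IsCoprime (Ideal.span {P}) (Ideal.span {Q}) := (Ideal.isCoprime_span_singleton_iff _ _).2 h
  rw [unitCount, unitCount, unitCount, ← Nat.card_prod, ← Ideal.span_singleton_mul_span_singleton]
  exact Nat.card_congr ((Units.mapEquiv (Ideal.quotientMulEquivQuotientProd _ _ hI).toMulEquiv).trans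
    MulEquiv.prodUnits).toEquiv

omit [Finite F] in
lemma unitDensity_mul_of_isCoprime {P Q : F[X]} (hP : P ≠ 0) (hQ : Q ≠ 0) (h : IsCoprime P Q) :
    unitDensity (P * Q) = unitDensity P * unitDensity Q := by
  rw [unitDensity, unitDensity, unitDensity, unitCount_mul_of_isCoprime h, natDegree_mul hP hQ]
  push_cast
  rw [pow_add, mul_div_mul_comm]

lemma unitDensity_of_irreducible {P : F[X]} (hP : Irreducible P) :
    unitDensity P = 1 - ((Nat.card F : ℚ) ^ P.natDegree)⁻¹ := by
  have hpos := natCard_cast_pos (F := F)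
  have : (Ideal.span {P}).IsMaximal := PrincipalIdealRing.isMaximal_of_irreducible hP
  let := Ideal.Quotient.field (Ideal.span {P})
  rw [unitDensity, unitCount, Nat.card_units, natCard_quotient_span_singleton hP.ne_zero,
    Nat.cast_sub (Nat.one_le_pow _ _ Nat.card_pos)]
  push_cast
  field_simp

omit [Finite F] in
lemma unitDensity_of_isUnit {P : F[X]} (hP : IsUnit P) : unitDensity P = 1 := by
  have : Subsingleton (F[X] ⧸ Ideal.span {P}) :=
    Ideal.Quotient.subsingleton_iff.2 (Ideal.span_singleton_eq_top.2 hP)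
  rw [unitDensity, unitCount, Nat.card_unique, natDegree_eq_zero_of_isUnit hP]
  simp

lemma unitDensity_eq_prod_primeFactors [DecidableEq F] {P : F[X]} (hP : P ≠ 0) :
    unitDensity P = ∏ p ∈ primeFactors P, (1 - ((Nat.card F : ℚ) ^ p.natDegree)⁻¹) := by
  classical
  induction P using UniqueFactorizationMonoid.induction_on_prime with
  | h₁ => exact absurd rfl hP
  | h₂ P hu => rw [unitDensity_of_isUnit hu, primeFactors_of_isUnit hu, Finset.prod_empty]
  | h₃ Q p hQ hp ih =>
    have hpf : primeFactors p = {normalize p} := by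
      ext; simp [mem_primeFactors, normalizedFactors_irreducible hp.irreducible]
    by_cases hd : p ∣ Q
    · rw [mul_comm p Q, unitDensity_mul_of_dvd hQ hp.ne_zero hd, ih hQ,
        primeFactors_mul_eq_union hQ hp.ne_zero, Finset.union_eq_left.2]
      rw [hpf, Finset.singleton_subset_iff, mem_primeFactors, mem_normalizedFactors_iff' hQ]
      exact ⟨(normalize_associated p).irreducible_iff.2 hp.irreducible, normalize_idem p,
        normalize_dvd_iff.2 hd⟩
    · have hc : IsCoprime p Q := (hp.irreducible.coprime_iff_not_dvd).2 hd
      rw [unitDensity_mul_of_isCoprime hp.ne_zero hQ hc, ih hQ,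
        primeFactors_mul_eq_disjUnion hc.isRelPrime, Finset.prod_disjUnion, hpf,
        Finset.prod_singleton, unitDensity_of_irreducible hp.irreducible,
        natDegree_eq_of_degree_eq degree_normalize]

omit [Finite F] in
lemma sum_natDegree_primeFactors_le [DecidableEq F] {P : F[X]} (hP : P ≠ 0) :
    ∑ p ∈ primeFactors P, p.natDegree ≤ P.natDegree := by
  classical
  induction P using UniqueFactorizationMonoid.induction_on_prime with
  | h₁ => exact absurd rfl hP
  | h₂ P hu => rw [primeFactors_of_isUnit hu]; simp
  | h₃ Q p hQ hp ih =>
    have hpf : primeFactors p = {normalize p} := by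
      ext; simp [mem_primeFactors, normalizedFactors_irreducible hp.irreducible]
    rw [primeFactors_mul_eq_union hp.ne_zero hQ, natDegree_mul hp.ne_zero hQ]
    calc _ ≤ ∑ p ∈ primeFactors p, p.natDegree + ∑ p ∈ primeFactors Q, p.natDegree := by
          rw [← Finset.sum_union_inter]; exact Nat.le_add_right _ _
      _ ≤ _ := by
          rw [hpf, Finset.sum_singleton, natDegree_eq_of_degree_eq degree_normalize]
          exact Nat.add_le_add_left (ih hQ) _

end UnitDensity

/-! ### Constraints on prime factors from roots and parity. -/

section PrimeFactors

variable {F : Type*} [Field F] [DecidableEq F]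

lemma mem_primeFactors_iff_monic {P : F[X]} (hP : P ≠ 0) {p : F[X]} :
    p ∈ primeFactors P ↔ Irreducible p ∧ p.Monic ∧ p ∣ P := by
  rw [mem_primeFactors, mem_normalizedFactors_iff' hP]
  refine and_congr_right fun hp => and_congr_left fun _ => ?_
  rw [normalize_eq_self_iff_monic hp.ne_zero]

lemma exists_mem_primeFactors_odd_natDegree {P : F[X]} (hP : P ≠ 0) (hodd : Odd P.natDegree) :
    ∃ p ∈ primeFactors P, Odd p.natDegree := by
  by_contra! h
  rw [← Nat.not_even_iff_odd] at hodd
  refine hodd ?_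
  rw [← natDegree_eq_of_degree_eq (degree_eq_degree_of_associated (prod_normalizedFactors hP)),
    natDegree_multiset_prod _ (zero_notMem_normalizedFactors P)]
  refine Multiset.sum_induction Even _ (fun _ _ => Even.add) Even.zero fun d hd => ?_
  obtain ⟨p, hp, rfl⟩ := Multiset.mem_map.1 hd
  exact Nat.not_odd_iff_even.1 (h p (mem_primeFactors.2 hp))

lemma card_linear_primeFactors_le [Finite F] {P : F[X]} (hP : P ≠ 0) (S : Finset F)
    (hS : ∀ x ∈ S, P.eval x ≠ 0) :
    ((primeFactors P).filter (fun p => p.natDegree = 1)).card ≤ Nat.card F - S.card := by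
  have := Fintype.ofFinite F
  rw [Nat.card_eq_fintype_card, ← Finset.card_compl]
  refine (Finset.card_le_card (t := Sᶜ.image fun a => X - C a) fun p hp => ?_).trans
    Finset.card_image_le
  obtain ⟨hp, hd⟩ := Finset.mem_filter.1 hp
  obtain ⟨-, hm, hdvd⟩ := (mem_primeFactors_iff_monic hP).1 hp
  have hpX : p = X - C (-p.coeff 0) := by
    rw [C_neg, sub_neg_eq_add]; exact hm.eq_X_add_C hd
  refine Finset.mem_image.2 ⟨-p.coeff 0, Finset.mem_compl.2 fun hx => hS _ hx ?_, hpX.symm⟩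
  exact dvd_iff_isRoot.1 (hpX ▸ hdvd)

end PrimeFactors

/-! ### Lower bounds for the density. -/

section LowerBound

variable {F : Type*} [Field F] [Finite F]

lemma one_sub_inv_pow_nonneg (d : ℕ) : (0 : ℚ) ≤ 1 - ((Nat.card F : ℚ) ^ d)⁻¹ :=
  sub_nonneg.2 (inv_le_one_of_one_le₀ (one_le_pow₀ (one_lt_natCard_cast (F := F)).le))

lemma one_sub_inv_pow_le_one (d : ℕ) : 1 - ((Nat.card F : ℚ) ^ d)⁻¹ ≤ 1 := by
  have := natCard_cast_pos (F := F)
  exact sub_le_self _ (by positivity)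

lemma one_sub_inv_pow_mono {d e : ℕ} (h : d ≤ e) :
    1 - ((Nat.card F : ℚ) ^ d)⁻¹ ≤ 1 - ((Nat.card F : ℚ) ^ e)⁻¹ := by
  have h0 := natCard_cast_pos (F := F)
  have h1 := (one_lt_natCard_cast (F := F)).le
  gcongr

/-- Trading an unused linear slot for a quadratic one only raises the product. The cap k on linear
primes comes from q - n or from the degree; the final + 1 is slack for an odd leftover. -/
lemma unitDensity_ge_of_card_linear_le {P : F[X]} (hP : P ≠ 0) (S : Finset F)
    (hS : ∀ x ∈ S, P.eval x ≠ 0) {k r : ℕ} (hk : Nat.card F - S.card ≤ k ∨ P.natDegree ≤ k)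
    (hr : P.natDegree ≤ k + 2 * r + 1) :
    (1 - ((Nat.card F : ℚ) ^ 1)⁻¹) ^ k * (1 - ((Nat.card F : ℚ) ^ 2)⁻¹) ^ r ≤ unitDensity P := by
  classical
  have hsum := sum_natDegree_primeFactors_le hP
  rw [unitDensity_eq_prod_primeFactors hP,
    ← Finset.prod_filter_mul_prod_filter_not _ (fun p : F[X] => p.natDegree = 1)]
  rw [← Finset.sum_filter_add_sum_filter_not _ (fun p : F[X] => p.natDegree = 1)] at hsum
  have hlin := card_linear_primeFactors_le hP S hS
  set A := (primeFactors P).filter (fun p => p.natDegree = 1)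
  set B := (primeFactors P).filter (fun p => ¬ p.natDegree = 1)
  have hA : ∀ p ∈ A, p.natDegree = 1 := fun p hp => (Finset.mem_filter.1 hp).2
  have hB : ∀ p ∈ B, 2 ≤ p.natDegree := fun p hp => by
    obtain ⟨hp, hne⟩ := Finset.mem_filter.1 hp
    have := ((mem_primeFactors_iff_monic hP).1 hp).1.natDegree_pos
    omega
  have hsA : ∑ p ∈ A, p.natDegree = A.card := by
    rw [Finset.sum_congr rfl hA, Finset.sum_const, smul_eq_mul, mul_one]
  have hsB : B.card * 2 ≤ ∑ p ∈ B, p.natDegree := by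
    rw [← smul_eq_mul]; exact Finset.card_nsmul_le_sum _ _ _ hB
  have hAk : A.card ≤ k := by omega
  obtain ⟨c, rfl⟩ := Nat.exists_eq_add_of_le hAk
  set x : ℚ := 1 - ((Nat.card F : ℚ) ^ 1)⁻¹
  set y : ℚ := 1 - ((Nat.card F : ℚ) ^ 2)⁻¹
  have hx : 0 ≤ x := one_sub_inv_pow_nonneg (F := F) 1
  have hy : 0 ≤ y := one_sub_inv_pow_nonneg (F := F) 2
  have hy1 : y ≤ 1 := one_sub_inv_pow_le_one (F := F) 2
  have hxy : x ≤ y := one_sub_inv_pow_mono (F := F) (by norm_num)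
  have hprodA : ∏ p ∈ A, (1 - ((Nat.card F : ℚ) ^ p.natDegree)⁻¹) = x ^ A.card := by
    rw [Finset.prod_congr rfl fun p hp => by rw [hA p hp], Finset.prod_const]
  have hprodB : y ^ B.card ≤ ∏ p ∈ B, (1 - ((Nat.card F : ℚ) ^ p.natDegree)⁻¹) := by
    rw [← Finset.prod_const]
    exact Finset.prod_le_prod (fun _ _ => hy) fun p hp => one_sub_inv_pow_mono (hB p hp)
  calc x ^ (A.card + c) * y ^ r = x ^ A.card * (x ^ c * y ^ r) := by ring
    _ ≤ x ^ A.card * (y ^ c * y ^ r) := by gcongr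
    _ = x ^ A.card * y ^ (c + r) := by rw [pow_add]
    -- The degree budget gives 2 * `B.card` ≤ c + 2r + 1, hence `B.card` ≤ c + r, also when c = 0.
    _ ≤ x ^ A.card * y ^ B.card := by
      gcongr x ^ A.card * ?_
      exact pow_le_pow_of_le_one hy hy1 (by omega)
    _ ≤ _ := by rw [hprodA]; gcongr

lemma unitDensity_ge_of_forall_eval_ne_zero_of_odd {P : F[X]} (hP : P ≠ 0)
    (hS : ∀ x, P.eval x ≠ 0) (hodd : Odd P.natDegree) {r : ℕ} (hr : P.natDegree ≤ 2 * r + 3) :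
    (1 - ((Nat.card F : ℚ) ^ 2)⁻¹) ^ r * (1 - ((Nat.card F : ℚ) ^ 3)⁻¹) ≤ unitDensity P := by
  classical
  obtain ⟨p₀, hp₀, hodd₀⟩ := exists_mem_primeFactors_odd_natDegree hP hodd
  have h2 : ∀ p ∈ primeFactors P, 2 ≤ p.natDegree := fun p hp => by
    obtain ⟨hirr, hm, hdvd⟩ := (mem_primeFactors_iff_monic hP).1 hp
    have hpos := hirr.natDegree_pos
    by_contra! hlt
    obtain ⟨x, hx⟩ := exists_root_of_degree_eq_one (degree_eq_iff_natDegree_eq_of_pos one_pos |>.2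
      (show p.natDegree = 1 by omega))
    exact hS x (hx.dvd hdvd)
  have h3 : 3 ≤ p₀.natDegree := by
    have := h2 p₀ hp₀
    obtain ⟨m, hm⟩ := hodd₀
    omega
  have hsum := sum_natDegree_primeFactors_le hP
  rw [← Finset.sum_erase_add _ _ hp₀] at hsum
  have hB : ((primeFactors P).erase p₀).card * 2 ≤
      ∑ p ∈ (primeFactors P).erase p₀, p.natDegree := by
    rw [← smul_eq_mul]
    exact Finset.card_nsmul_le_sum _ _ _ fun p hp => h2 p (Finset.mem_of_mem_erase hp)
  rw [unitDensity_eq_prod_primeFactors hP, ← Finset.prod_erase_mul _ _ hp₀]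
  have hy := one_sub_inv_pow_nonneg (F := F) 2
  refine mul_le_mul ?_ (one_sub_inv_pow_mono h3) (one_sub_inv_pow_nonneg 3)
    (Finset.prod_nonneg fun _ _ => one_sub_inv_pow_nonneg _)
  refine (pow_le_pow_of_le_one hy (one_sub_inv_pow_le_one 2)
    (show ((primeFactors P).erase p₀).card ≤ r by omega)).trans ?_
  rw [← Finset.prod_const]
  exact Finset.prod_le_prod (fun _ _ => hy) fun p hp =>
    one_sub_inv_pow_mono (h2 p (Finset.mem_of_mem_erase hp))

end LowerBound

/-! ### Irreducible polynomials and the density of their products. -/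

section Witness

variable {F : Type*} [Field F] [Finite F]

/-- As l is prime, every element of the degree l extension outside F has a minimal polynomial of
degree l, shared by at most l elements. -/
lemma exists_finset_monic_irreducible_natDegree_eq {l : ℕ} (hl : l.Prime) {r : ℕ}
    (hr : l * r ≤ Nat.card F ^ l - Nat.card F) :
    ∃ B : Finset F[X], B.card = r ∧ ∀ p ∈ B, p.Monic ∧ Irreducible p ∧ p.natDegree = l := by
  classical
  have : NeZero l := ⟨hl.ne_zero⟩
  obtain ⟨c, hc⟩ := CharP.exists F
  have : Fact c.Prime := ⟨CharP.char_is_prime F c⟩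
  let E := FiniteField.Extension F c l
  have := Fintype.ofFinite E
  have := Fintype.ofFinite F
  let G : Finset E := (Finset.univ.image (algebraMap F E))ᶜ
  have hint : ∀ x : E, IsIntegral F x := fun x => Algebra.IsIntegral.isIntegral x
  have hG : G.card = Nat.card F ^ l - Nat.card F := by
    rw [Finset.card_compl, Finset.card_image_of_injective _ (algebraMap F E).injective,
      Finset.card_univ, Fintype.card_eq_nat_card, Fintype.card_eq_nat_card,
      FiniteField.natCard_extension]
  have hdeg : ∀ x ∈ G, (minpoly F x).natDegree = l := fun x hx => by
    have hdvd : (minpoly F x).natDegree ∣ l := by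
      have := minpoly.degree_dvd (hint x)
      rwa [FiniteField.finrank_extension] at this
    refine (hl.eq_one_or_self_of_dvd _ hdvd).resolve_left fun h1 => ?_
    obtain ⟨a, ha⟩ := minpoly.natDegree_eq_one_iff.1 h1
    exact Finset.mem_compl.1 hx (Finset.mem_image.2 ⟨a, Finset.mem_univ _, ha⟩)
  have hcard : G.card ≤ l * (G.image (minpoly F)).card := by
    refine Finset.card_le_mul_card_image _ _ fun p hp => ?_
    obtain ⟨y, hy, rfl⟩ := Finset.mem_image.1 hp
    refine le_trans ?_ ((natDegree_map (algebraMap F E)).trans (hdeg y hy)).le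
    refine (Finset.card_le_card (t := ((minpoly F y).map (algebraMap F E)).roots.toFinset)
      fun x hx => ?_).trans ((Multiset.toFinset_card_le _).trans (card_roots' _))
    rw [Multiset.mem_toFinset, mem_roots (map_ne_zero (minpoly.ne_zero (hint y))), IsRoot,
      eval_map_algebraMap, ← (Finset.mem_filter.1 hx).2]
    exact minpoly.aeval F x
  obtain ⟨B, hB, hBr⟩ := Finset.exists_subset_card_eq
    (show r ≤ (G.image (minpoly F)).card from
      Nat.le_of_mul_le_mul_left (hr.trans (hG ▸ hcard)) hl.pos)
  refine ⟨B, hBr, fun p hp => ?_⟩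
  obtain ⟨x, hx, rfl⟩ := Finset.mem_image.1 (hB hp)
  exact ⟨minpoly.monic (hint x), minpoly.irreducible (hint x), hdeg x hx⟩

lemma unitDensity_prod_monic_irreducible (T : Finset F[X])
    (hT : ∀ p ∈ T, p.Monic ∧ Irreducible p) :
    unitDensity (∏ p ∈ T, p) = ∏ p ∈ T, (1 - ((Nat.card F : ℚ) ^ p.natDegree)⁻¹) := by
  classical
  induction T using Finset.induction_on with
  | empty => simpa using unitDensity_of_isUnit (F := F) isUnit_one
  | insert p T hp ih =>
    have hT' := fun t ht => hT t (Finset.mem_insert_of_mem ht)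
    obtain ⟨hpm, hpi⟩ := hT p (Finset.mem_insert_self _ _)
    rw [Finset.prod_insert hp, Finset.prod_insert hp, unitDensity_mul_of_isCoprime hpi.ne_zero
      (Finset.prod_ne_zero_iff.2 fun t ht => (hT' t ht).1.ne_zero), ih hT',
      unitDensity_of_irreducible hpi]
    refine IsCoprime.prod_right fun t ht => (hpi.coprime_iff_not_dvd).2 fun hdvd => hp ?_
    have := eq_of_monic_of_associated hpm (hT' t ht).1 (hpi.associated_of_dvd (hT' t ht).2 hdvd)
    rwa [this]

omit [Finite F] in
lemma eval_ne_zero_of_irreducible_of_natDegree_ne_one {p : F[X]} (hp : Irreducible p)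
    (hd : p.natDegree ≠ 1) (x : F) : p.eval x ≠ 0 := fun hx =>
  hd (natDegree_eq_of_degree_eq_some (degree_eq_one_of_irreducible_of_root hp hx))

lemma unitCount_eq_unitDensity_mul (P : F[X]) :
    (unitCount P : ℚ) = unitDensity P * (Nat.card F : ℚ) ^ P.natDegree := by
  have := natCard_cast_pos (F := F)
  rw [unitDensity, div_mul_cancel₀ _ (by positivity)]

end Witness

/-! ### Attaining the bounds. -/

section Minimum

variable {F : Type*} [Field F] [Finite F]

lemma cast_pow_mul_pow_mul_pow_eq (e k r : ℕ) :
    ((Nat.card F ^ e * (Nat.card F - 1) ^ k * (Nat.card F ^ 2 - 1) ^ r : ℕ) : ℚ) =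
      (1 - ((Nat.card F : ℚ) ^ 1)⁻¹) ^ k * (1 - ((Nat.card F : ℚ) ^ 2)⁻¹) ^ r *
        (Nat.card F : ℚ) ^ (k + 2 * r + e) := by
  have hq := natCard_cast_pos (F := F)
  have h1 : ((Nat.card F - 1 : ℕ) : ℚ) = (1 - ((Nat.card F : ℚ) ^ 1)⁻¹) * Nat.card F := by
    rw [Nat.cast_sub Nat.card_pos]
    field_simp
    simp
  have h2 : ((Nat.card F ^ 2 - 1 : ℕ) : ℚ) =
      (1 - ((Nat.card F : ℚ) ^ 2)⁻¹) * (Nat.card F : ℚ) ^ 2 := by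
    rw [Nat.cast_sub (Nat.one_le_pow _ _ Nat.card_pos)]
    field_simp
    simp
  rw [Nat.cast_mul, Nat.cast_mul, Nat.cast_pow, Nat.cast_pow, Nat.cast_pow, h1, h2, mul_pow,
    mul_pow]
  ring

lemma cast_pow_mul_cube_sub_one_eq (r : ℕ) :
    (((Nat.card F ^ 2 - 1) ^ r * (Nat.card F ^ 3 - 1) : ℕ) : ℚ) =
      (1 - ((Nat.card F : ℚ) ^ 2)⁻¹) ^ r * (1 - ((Nat.card F : ℚ) ^ 3)⁻¹) *
        (Nat.card F : ℚ) ^ (2 * r + 3) := by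
  have hq := natCard_cast_pos (F := F)
  have h3 : ((Nat.card F ^ 3 - 1 : ℕ) : ℚ) =
      (1 - ((Nat.card F : ℚ) ^ 3)⁻¹) * (Nat.card F : ℚ) ^ 3 := by
    rw [Nat.cast_sub (Nat.one_le_pow _ _ Nat.card_pos)]
    field_simp
    simp
  have h2 := cast_pow_mul_pow_mul_pow_eq (F := F) 0 0 r
  simp only [pow_zero, one_mul, zero_add, add_zero] at h2
  rw [Nat.cast_mul, h2, h3]
  ring

lemma exists_finset_monic_irreducible_quadratic {r : ℕ} (hr : 2 * r ≤ Nat.card F) :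
    ∃ B : Finset F[X], B.card = r ∧ ∀ p ∈ B, p.Monic ∧ Irreducible p ∧ p.natDegree = 2 := by
  refine exists_finset_monic_irreducible_natDegree_eq Nat.prime_two (hr.trans ?_)
  have : 2 ≤ Nat.card F := Finite.one_lt_card
  exact Nat.le_sub_of_add_le (by nlinarith)

lemma exists_monic_irreducible_cubic :
    ∃ p : F[X], p.Monic ∧ Irreducible p ∧ p.natDegree = 3 := by
  have : 2 ≤ Nat.card F := Finite.one_lt_card
  have h : 3 * 1 ≤ Nat.card F ^ 3 - Nat.card F := by
    refine Nat.le_sub_of_add_le ?_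
    nlinarith [Nat.pow_le_pow_left this 2]
  obtain ⟨B, hB, hp⟩ := exists_finset_monic_irreducible_natDegree_eq Nat.prime_three h
  obtain ⟨p, rfl⟩ := Finset.card_eq_one.1 hB
  exact ⟨p, hp p (Finset.mem_singleton_self p)⟩

lemma mem_unitCountValues_linear_quadratic (S : Finset F) {e k r : ℕ}
    (hk : k ≤ Nat.card F - S.card) (hr : 2 * r ≤ Nat.card F) (hek : e ≤ k) :
    Nat.card F ^ e * (Nat.card F - 1) ^ k * (Nat.card F ^ 2 - 1) ^ r ∈
      unitCountValues S (k + 2 * r + e) := by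
  classical
  have := Fintype.ofFinite F
  rw [Nat.card_eq_fintype_card, ← Finset.card_compl] at hk
  obtain ⟨A, hAS, hA⟩ := Finset.exists_subset_card_eq hk
  obtain ⟨B, hB, hBp⟩ := exists_finset_monic_irreducible_quadratic hr
  let L : Finset F[X] := A.image fun a => X - C a
  have hL : L.card = k := by
    rw [Finset.card_image_of_injective _ fun a b h => C_injective (sub_right_injective h), hA]
  have hLp : ∀ p ∈ L, p.Monic ∧ Irreducible p ∧ p.natDegree = 1 := fun p hp => by
    obtain ⟨a, -, rfl⟩ := Finset.mem_image.1 hp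
    exact ⟨monic_X_sub_C a, irreducible_X_sub_C a, natDegree_X_sub_C a⟩
  have hLB : Disjoint L B := Finset.disjoint_left.2 fun p hl hb => by
    have := (hLp p hl).2.2.symm.trans (hBp p hb).2.2
    omega
  have hT : ∀ p ∈ L ∪ B, p.Monic ∧ Irreducible p := fun p hp =>
    (Finset.mem_union.1 hp).elim (fun h => ⟨(hLp p h).1, (hLp p h).2.1⟩)
      fun h => ⟨(hBp p h).1, (hBp p h).2.1⟩
  have hTS : ∀ p ∈ L ∪ B, ∀ x ∈ S, p.eval x ≠ 0 := fun p hp x hx => by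
    rcases Finset.mem_union.1 hp with h | h
    · obtain ⟨a, ha, rfl⟩ := Finset.mem_image.1 h
      rw [eval_sub, eval_X, eval_C]
      exact sub_ne_zero.2 fun hxa => Finset.mem_compl.1 (hAS ha) (hxa ▸ hx)
    · exact eval_ne_zero_of_irreducible_of_natDegree_ne_one (hBp p h).2.1
        (by rw [(hBp p h).2.2]; norm_num) x
  -- Repeating e of the linear factors raises the degree by e and leaves the density unchanged,
  -- producing the factor q^e.
  obtain ⟨M, hML, hM⟩ := Finset.exists_subset_card_eq (hL ▸ hek : e ≤ L.card)
  have hMT : M ⊆ L ∪ B := hML.trans Finset.subset_union_left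
  have hP : (∏ p ∈ L ∪ B, p).Monic := monic_prod_of_monic _ _ fun p hp => (hT p hp).1
  have hQ : (∏ p ∈ M, p).Monic := monic_prod_of_monic _ _ fun p hp => (hT p (hMT hp)).1
  have hdeg : ((∏ p ∈ L ∪ B, p) * ∏ p ∈ M, p).natDegree = k + 2 * r + e := by
    rw [hP.natDegree_mul hQ, natDegree_prod_of_monic _ _ fun p hp => (hT p hp).1,
      natDegree_prod_of_monic _ _ fun p hp => (hT p (hMT hp)).1, Finset.sum_union hLB,
      Finset.sum_congr rfl fun p hp => (hLp p hp).2.2,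
      Finset.sum_congr rfl fun p hp => (hBp p hp).2.2,
      Finset.sum_congr rfl fun p hp => (hLp p (hML hp)).2.2]
    simp [hL, hB, hM, mul_comm]
  refine ⟨(∏ p ∈ L ∪ B, p) * ∏ p ∈ M, p, ?_, fun x hx => ?_, ?_⟩
  · rw [degree_eq_natDegree (hP.mul hQ).ne_zero, hdeg]
  · rw [eval_mul, eval_prod, eval_prod]
    exact mul_ne_zero (Finset.prod_ne_zero_iff.2 fun p hp => hTS p hp x hx)
      (Finset.prod_ne_zero_iff.2 fun p hp => hTS p (hMT hp) x hx)
  · rw [← Nat.cast_inj (R := ℚ), cast_pow_mul_pow_mul_pow_eq, unitCount_eq_unitDensity_mul, hdeg,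
      unitDensity_mul_of_dvd hP.ne_zero hQ.ne_zero (Finset.prod_dvd_prod_of_subset _ _ _ hMT),
      unitDensity_prod_monic_irreducible _ hT, Finset.prod_union hLB,
      Finset.prod_congr rfl fun p hp => by rw [(hLp p hp).2.2],
      Finset.prod_congr (s₁ := B) rfl fun p hp => by rw [(hBp p hp).2.2],
      Finset.prod_const, Finset.prod_const, hL, hB]

lemma mem_unitCountValues_quadratic_cubic (S : Finset F) {r : ℕ} (hr : 2 * r ≤ Nat.card F) :
    (Nat.card F ^ 2 - 1) ^ r * (Nat.card F ^ 3 - 1) ∈ unitCountValues S (2 * r + 3) := by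
  classical
  obtain ⟨B, hB, hBp⟩ := exists_finset_monic_irreducible_quadratic hr
  obtain ⟨c, hcm, hci, hcd⟩ := exists_monic_irreducible_cubic (F := F)
  have hcB : c ∉ B := fun h => by
    have := (hBp c h).2.2
    omega
  have hT : ∀ p ∈ insert c B, p.Monic ∧ Irreducible p ∧ p.natDegree ≠ 1 := fun p hp => by
    rcases Finset.mem_insert.1 hp with rfl | h
    · exact ⟨hcm, hci, by omega⟩
    · obtain ⟨h1, h2, h3⟩ := hBp p h
      exact ⟨h1, h2, by omega⟩
  have hP : (∏ p ∈ insert c B, p).Monic := monic_prod_of_monic _ _ fun p hp => (hT p hp).1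
  have hdeg : (∏ p ∈ insert c B, p).natDegree = 2 * r + 3 := by
    rw [natDegree_prod_of_monic _ _ fun p hp => (hT p hp).1, Finset.sum_insert hcB, hcd,
      Finset.sum_congr rfl fun p hp => (hBp p hp).2.2, Finset.sum_const, hB, smul_eq_mul]
    ring
  refine ⟨∏ p ∈ insert c B, p, ?_, fun x _ => ?_, ?_⟩
  · rw [degree_eq_natDegree hP.ne_zero, hdeg]
  · rw [eval_prod]
    exact Finset.prod_ne_zero_iff.2 fun p hp =>
      eval_ne_zero_of_irreducible_of_natDegree_ne_one (hT p hp).2.1 (hT p hp).2.2 x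
  · rw [← Nat.cast_inj (R := ℚ), cast_pow_mul_cube_sub_one_eq, unitCount_eq_unitDensity_mul, hdeg,
      unitDensity_prod_monic_irreducible _ fun p hp => ⟨(hT p hp).1, (hT p hp).2.1⟩,
      Finset.prod_insert hcB, hcd, Finset.prod_congr rfl fun p hp => by rw [(hBp p hp).2.2],
      Finset.prod_const, hB, mul_comm (1 - _)]

/-- Here e is the parity defect of the degree left after the linear factors; e ≤ k ensures there is
a linear factor to repeat. -/
lemma isLeast_unitCountValues_linear_quadratic (S : Finset F) {e k r h : ℕ}
    (hk : k = min (Nat.card F - S.card) h) (hh : h = k + 2 * r + e)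
    (hr : 2 * r ≤ Nat.card F) (he : e ≤ 1) (hek : e ≤ k) :
    IsLeast (unitCountValues S h)
      (Nat.card F ^ e * (Nat.card F - 1) ^ k * (Nat.card F ^ 2 - 1) ^ r) := by
  refine ⟨hh ▸ mem_unitCountValues_linear_quadratic S (hk.le.trans (min_le_left _ _)) hr hek, ?_⟩
  rintro _ ⟨P, hdeg, hS, rfl⟩
  have hP : P ≠ 0 := by
    rintro rfl
    exact WithBot.bot_ne_coe (degree_zero.symm.trans hdeg)
  have hd : P.natDegree = h := natDegree_eq_of_degree_eq_some hdeg
  rw [← Nat.cast_le (α := ℚ), cast_pow_mul_pow_mul_pow_eq, unitCount_eq_unitDensity_mul, hd, ← hh]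
  gcongr
  exact unitDensity_ge_of_card_linear_le hP S hS (by omega) (by omega)

lemma isLeast_unitCountValues_quadratic_cubic (S : Finset F) (hS : S.card = Nat.card F) {r : ℕ}
    (hr : 2 * r ≤ Nat.card F) :
    IsLeast (unitCountValues S (2 * r + 3))
      ((Nat.card F ^ 2 - 1) ^ r * (Nat.card F ^ 3 - 1)) := by
  have := Fintype.ofFinite F
  refine ⟨mem_unitCountValues_quadratic_cubic S hr, ?_⟩
  rintro _ ⟨P, hdeg, hPS, rfl⟩
  have hP : P ≠ 0 := by
    rintro rfl
    exact WithBot.bot_ne_coe (degree_zero.symm.trans hdeg)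
  have hd : P.natDegree = 2 * r + 3 := natDegree_eq_of_degree_eq_some (mod_cast hdeg)
  have hSuniv : S = Finset.univ := by
    rwa [← Finset.card_eq_iff_eq_univ, ← Nat.card_eq_fintype_card]
  rw [← Nat.cast_le (α := ℚ), cast_pow_mul_cube_sub_one_eq, unitCount_eq_unitDensity_mul, hd]
  gcongr
  exact unitDensity_ge_of_forall_eval_ne_zero_of_odd hP
    (fun x => hPS x (hSuniv ▸ Finset.mem_univ x)) (hd ▸ ⟨r + 1, by ring⟩) hd.le

end Minimum

theorem lemma51 {F : Type*} [Field F] [Finite F] (S : Finset F) (q n h : ℕ)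
    (hq : Nat.card F = q) (hn : S.card = n) (h_pos : 0 < h) (h_lt : h < q) :
    (n + h ≤ q → IsLeast (unitCountValues S h) ((q - 1) ^ h)) ∧
    (n < q → q < n + h → Even (n + h - q) →
      IsLeast (unitCountValues S h) ((q - 1) ^ (q - n) * (q ^ 2 - 1) ^ ((n + h - q) / 2))) ∧
    (n < q → q < n + h → Odd (n + h - q) →
      IsLeast (unitCountValues S h)
        (q * (q - 1) ^ (q - n) * (q ^ 2 - 1) ^ ((n + h - q - 1) / 2))) ∧
    (q = n → Even h → IsLeast (unitCountValues S h) ((q ^ 2 - 1) ^ (h / 2))) ∧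
    (q = n → Odd h → 3 ≤ h →
      IsLeast (unitCountValues S h) ((q ^ 2 - 1) ^ ((h - 3) / 2) * (q ^ 3 - 1))) := by
  subst hq hn
  refine ⟨fun h1 => ?_, fun h1 h2 h3 => ?_, fun h1 h2 h3 => ?_, fun h1 h2 => ?_,
    fun h1 h2 h3 => ?_⟩
  -- The degree is the binding constraint: h distinct linear factors fit.
  · simpa using isLeast_unitCountValues_linear_quadratic S (e := 0) (k := h) (r := 0) (h := h)
      (by omega) (by omega) (by omega) (by omega) (by omega)
  · obtain ⟨m, hm⟩ := h3
    simpa using isLeast_unitCountValues_linear_quadratic S (e := 0) (k := Nat.card F - S.card)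
      (r := (S.card + h - Nat.card F) / 2) (h := h)
      (by omega) (by omega) (by omega) (by omega) (by omega)
  · obtain ⟨m, hm⟩ := h3
    simpa using isLeast_unitCountValues_linear_quadratic S (e := 1) (k := Nat.card F - S.card)
      (r := (S.card + h - Nat.card F - 1) / 2) (h := h)
      (by omega) (by omega) (by omega) (by omega) (by omega)
  · obtain ⟨m, hm⟩ := h2
    simpa using isLeast_unitCountValues_linear_quadratic S (e := 0) (k := 0) (r := h / 2) (h := h)
      (by omega) (by omega) (by omega) (by omega) (by omega)
  · obtain ⟨m, rfl⟩ := h2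
    obtain ⟨r, rfl⟩ := Nat.exists_eq_add_of_le (show 1 ≤ m by omega)
    have hr : (2 * (1 + r) + 1 - 3) / 2 = r := by omega
    have hh : 2 * (1 + r) + 1 = 2 * r + 3 := by ring
    rw [hr, hh]
    exact isLeast_unitCountValues_quadratic_cubic S h1.symm (by omega)
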